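/- Let $(X,\mathscr A,\mu)$ be a $\sigma$-finite measure space, let $\phi\colon X\to X$ and $w\colon X\to\mathbb C$ be $\mathscr A$-measurable, put $\mu_w(\sigma)=\int_\sigma|w|^2\,d\mu$ for $\sigma\in\mathscr A$, and assume that $\mu_w\circ\phi^{-1}$ is absolutely continuous with respect to $\mu$, with Radon--Nikodym derivative $\mathsf h_{\phi,w}\colon X\to[0,\infty]$. Let $C_{\phi,w}$ be the weighted composition operator in the complex Hilbert space $L^2(\mu)$ with domain $\{f\in L^2(\mu): w\cdot(f\circ\phi)\in L^2(\mu)\}$, given by $C_{\phi,w}f=w\cdot(f\circ\phi)$, and assume that it is densely defined. For an operator $T$ in a Hilbert space with domain $\mathcal D(T)$, kernel $\mathcal N(T)$ and range $\mathcal R(T)$, its reciprocal (maximal Tseng inverse), when it exists, is the unique operator $T^\dagger$ with domain $\mathcal R(T)\oplus\mathcal R(T)^\perp$ such that $TT^\dagger f=P_{\overline{\mathcal R(T)}}f$ for all $f$ in the domain of $T^\dagger$, $T^\dagger Tg=P_{\mathcal N(T)^\perp}g$ for all $g\in\mathcal D(T)$, and $\mathcal N(T^\dagger)=\mathcal R(T)^\perp$,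 where $P_M$ denotes the orthogonal projection onto a closed subspace $M$. For $f\in L^2(\mu)$ put $f_w=f/w$ on $\{w\neq0\}$ and $f_w=0$ on $\{w=0\}$; then $f_w\in L^2(\mu_w)$. For $F\in L^2(\mu_w)$ let $\mathsf E_{\phi,w}(F)$ be the conditional expectation of $F$ with respect to the $\sigma$-algebra $\phi^{-1}(\mathscr A)$ and the measure $\mu_w$, and let $\mathsf E_{\phi,w}(F)\circ\phi^{-1}$ denote the ($\mu$-a.e. unique) $\mathscr A$-measurable function $g\colon X\to\mathbb C$ with $g=0$ $\mu$-a.e. on $\{\mathsf h_{\phi,w}=0\}$ and $\mathsf E_{\phi,w}(F)=g\circ\phi$ $\mu_w$-a.e. Then the reciprocal $C_{\phi,w}^\dagger$ exists, and the following conditions hold: (i) the domain of $C_{\phi,w}^\dagger$ is $\{f\in L^2(\mu): \mathsf E_{\phi,w}(f_w)\circ\phi^{-1}\in L^2(\mu)\}$; (ii) $C_{\phi,w}^\dagger f=\mathsf E_{\phi,w}(f_w)\circ\phi^{-1}$ for every $f$ in the domain of $C_{\phi,w}^\dagger$. -/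

import Mathlib

open MeasureTheory
open scoped ENNReal

noncomputable section

namespace WCO

/-! ### Reciprocals (maximal Tseng inverses) of operators in a Hilbert space -/

section Reciprocal

variable {H : Type*} [NormedAddCommGroup H] [InnerProductSpace ℂ H]

/-- The kernel of an operator, as a subspace of the ambient space. -/
def kernel (T : H →ₗ.[ℂ] H) : Submodule ℂ H :=
  (LinearMap.ker T.toFun).map T.domain.subtype

/-- The range of an operator. -/
def range (T : H →ₗ.[ℂ] H) : Submodule ℂ H :=
  LinearMap.range T.toFun

variable [CompleteSpace H]

/-- `S` is a reciprocal of `T`: the domain of `S` is `ran T ⊕ (ran T)ᗮ`, `T S f` is the orthogonal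
projection of `f` onto the closure of `ran T`, `S T g` is the orthogonal projection of `g` onto
`(ker T)ᗮ`, and `ker S = (ran T)ᗮ`. -/
structure IsReciprocal (T S : H →ₗ.[ℂ] H) : Prop where
  domain_eq : S.domain = range T ⊔ (range T)ᗮ
  apply_apply : ∀ f : S.domain, ∃ h : S f ∈ T.domain,
    T ⟨S f, h⟩ = (range T).topologicalClosure.starProjection (f : H)
  symm_apply_apply : ∀ g : T.domain, ∃ h : T g ∈ S.domain,
    S ⟨T g, h⟩ = (kernel T)ᗮ.starProjection (g : H)
  kernel_eq : kernel S = (range T)ᗮ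

open Classical in
/-- The reciprocal of `T`, that is, the operator `S` with `IsReciprocal T S`. It is unique, and it
exists if the domain of `T` is the sum of `ker T` and `dom T ∩ (ker T)ᗮ`; otherwise the value is a
dummy. -/
def reciprocal (T : H →ₗ.[ℂ] H) : H →ₗ.[ℂ] H :=
  if h : ∃ S, IsReciprocal T S then h.choose else ⊥

theorem IsReciprocal.unique {T S S' : H →ₗ.[ℂ] H} (h : IsReciprocal T S)
    (h' : IsReciprocal T S') : S = S' := by
  have key : ∀ {R : H →ₗ.[ℂ] H}, IsReciprocal T R → ∀ (f : R.domain) (g : T.domain) (k : H),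
      k ∈ (range T)ᗮ → T g + k = f → R f = (kernel T)ᗮ.starProjection (g : H) := by
    intro R hR f g k hk hf
    obtain ⟨h1, h2⟩ := hR.symm_apply_apply g
    rw [← hR.kernel_eq] at hk
    obtain ⟨k', hk', rfl⟩ := hk
    have : f = ⟨T g, h1⟩ + k' := Subtype.ext (by simpa using hf.symm)
    rw [this, R.map_add, h2]
    have hk0 : R k' = 0 := hk'
    rw [hk0, add_zero]
  refine LinearPMap.ext (h.domain_eq.trans h'.domain_eq.symm) ?_
  intro x hx hy
  obtain ⟨y, ⟨g, rfl⟩, k, hk, hgk⟩ := Submodule.mem_sup.1 (h.domain_eq ▸ hx)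
  rw [key h ⟨x, hx⟩ g k hk hgk, key h' ⟨x, hy⟩ g k hk hgk]

theorem exists_isReciprocal (T : H →ₗ.[ℂ] H)
    (hT : T.domain = kernel T ⊔ (T.domain ⊓ (kernel T)ᗮ)) : ∃ S, IsReciprocal T S := by
  let G : Submodule ℂ (H × H) :=
    { carrier := {p | ∃ h : p.2 ∈ T.domain, p.2 ∈ (kernel T)ᗮ ∧ p.1 - T ⟨p.2, h⟩ ∈ (range T)ᗮ}
      zero_mem' := by
        refine ⟨T.domain.zero_mem, Submodule.zero_mem _, ?_⟩
        have : T ⟨0, T.domain.zero_mem⟩ = 0 := T.map_zero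
        simp [this]
      add_mem' := by
        rintro p q ⟨hp, hp1, hp2⟩ ⟨hq, hq1, hq2⟩
        refine ⟨T.domain.add_mem hp hq, Submodule.add_mem _ hp1 hq1, ?_⟩
        have : T ⟨(p + q).2, T.domain.add_mem hp hq⟩ = T ⟨p.2, hp⟩ + T ⟨q.2, hq⟩ :=
          T.map_add ⟨p.2, hp⟩ ⟨q.2, hq⟩
        rw [this]
        convert Submodule.add_mem _ hp2 hq2 using 1
        simp only [Prod.fst_add]
        abel
      smul_mem' := by
        rintro c p ⟨hp, hp1, hp2⟩
        refine ⟨T.domain.smul_mem c hp, Submodule.smul_mem _ c hp1, ?_⟩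
        have : T ⟨(c • p).2, T.domain.smul_mem c hp⟩ = c • T ⟨p.2, hp⟩ :=
          T.map_smul c ⟨p.2, hp⟩
        rw [this]
        convert Submodule.smul_mem _ c hp2 using 1
        simp [smul_sub] }
  have mem_ker : ∀ g : T.domain, T g = 0 → (g : H) ∈ kernel T := fun g hg => ⟨g, hg, rfl⟩
  have mem_ran : ∀ g : T.domain, T g ∈ range T := fun g => ⟨g, rfl⟩
  have zero_of : ∀ {K : Submodule ℂ H} {x : H}, x ∈ K → x ∈ Kᗮ → x = 0 := by
    intro K x h1 h2
    exact inner_self_eq_zero.1 (h2 x h1)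
  have hG : ∀ x ∈ G, x.1 = 0 → x.2 = 0 := by
    rintro ⟨a, b⟩ ⟨hb, hb1, hb2⟩ (rfl : a = 0)
    have h0 : T ⟨b, hb⟩ = 0 := by
      refine zero_of (mem_ran _) ?_
      simpa using hb2
    exact zero_of (mem_ker _ h0) hb1
  have hgr : ∀ f g, (f, g) ∈ G.toLinearPMap.graph ↔ (f, g) ∈ G := by
    intro f g
    rw [Submodule.toLinearPMap_graph_eq G hG]
  have happ : ∀ (f : G.toLinearPMap.domain), ((f : H), G.toLinearPMap f) ∈ G := fun f =>
    (hgr _ _).1 (LinearPMap.mem_graph _ f)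
  have hval : ∀ {f g : H}, (f, g) ∈ G → ∃ h : f ∈ G.toLinearPMap.domain,
      G.toLinearPMap ⟨f, h⟩ = g := by
    intro f g h
    obtain ⟨y, hy, hy'⟩ := (LinearPMap.mem_graph_iff _).1 ((hgr _ _).2 h)
    subst hy
    exact ⟨y.2, hy'⟩
  -- each value of `T` is attained on the orthogonal complement of the kernel
  have hdec : ∀ g : T.domain, (T g, (kernel T)ᗮ.starProjection (g : H)) ∈ G := by
    intro g
    have hg : (g : H) ∈ kernel T ⊔ (T.domain ⊓ (kernel T)ᗮ) := hT ▸ g.2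
    obtain ⟨_, ⟨k, hk, rfl⟩, n, ⟨hn, hn'⟩, hkn⟩ := Submodule.mem_sup.1 hg
    have hk0 : T k = 0 := hk
    have hp : (kernel T)ᗮ.starProjection (g : H) = n := by
      refine Submodule.eq_starProjection_of_mem_orthogonal hn' ?_
      have : (g : H) - n = k := by rw [← hkn]; simp
      rw [this]
      exact Submodule.le_orthogonal_orthogonal _ (mem_ker k hk0)
    have hTg : T g = T ⟨n, hn⟩ := by
      have : g = k + ⟨n, hn⟩ := Subtype.ext (by simpa using hkn.symm)
      rw [this, T.map_add, hk0, zero_add]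
    rw [hp]
    refine ⟨hn, hn', ?_⟩
    simp [hTg]
  refine ⟨G.toLinearPMap, ?_, ?_, fun g => hval (hdec g), ?_⟩
  · apply le_antisymm
    · intro f hf
      obtain ⟨h1, -, h3⟩ := happ ⟨f, hf⟩
      exact Submodule.mem_sup.2 ⟨_, mem_ran ⟨_, h1⟩, _, h3, by simp⟩
    · refine sup_le ?_ ?_
      · rintro _ ⟨g, rfl⟩
        exact (hval (hdec g)).1
      · intro k hk
        have : (k, (0 : H)) ∈ G := by
          refine ⟨T.domain.zero_mem, Submodule.zero_mem _, ?_⟩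
          have : T ⟨0, T.domain.zero_mem⟩ = 0 := T.map_zero
          simpa [this] using hk
        exact (hval this).1
  · intro f
    obtain ⟨h1, -, h3⟩ := happ f
    refine ⟨h1, ?_⟩
    symm
    refine Submodule.eq_starProjection_of_mem_orthogonal
      (Submodule.le_topologicalClosure _ (mem_ran _)) ?_
    rw [Submodule.orthogonal_closure]
    exact h3
  · ext f
    constructor
    · rintro ⟨f, hf, rfl⟩
      obtain ⟨h1, -, h3⟩ := happ f
      have hf0 : G.toLinearPMap f = 0 := hf
      have : T ⟨_, h1⟩ = 0 := by
        have e : (⟨_, h1⟩ : T.domain) = 0 := Subtype.ext hf0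
        rw [e, T.map_zero]
      rw [this] at h3
      simpa using h3
    · intro hk
      have : (f, (0 : H)) ∈ G := by
        refine ⟨T.domain.zero_mem, Submodule.zero_mem _, ?_⟩
        have : T ⟨0, T.domain.zero_mem⟩ = 0 := T.map_zero
        simpa [this] using hk
      obtain ⟨h1, h2⟩ := hval this
      exact ⟨⟨f, h1⟩, h2, rfl⟩

end Reciprocal

/-! ### Weighted composition operators -/

section Operator

variable {X : Type*} [MeasurableSpace X]

/-- The measure `μ_w(σ) = ∫_σ |w|² dμ`. -/
def wMeasure (μ : Measure X) (w : X → ℂ) : Measure X :=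
  μ.withDensity fun x => ‖w x‖ₑ ^ 2

/-- The Radon-Nikodym derivative of `μ_w ∘ φ⁻¹` with respect to `μ`, with values in `[0, ∞]`. -/
def radonNikodym (μ : Measure X) (φ : X → X) (w : X → ℂ) : X → ℝ≥0∞ :=
  ((wMeasure μ w).map φ).rnDeriv μ

theorem ae_comp_of_ae {μ : Measure X} {φ : X → X} {w : X → ℂ} (hφ : Measurable φ)
    (hw : Measurable w) (hac : (wMeasure μ w).map φ ≪ μ) {p : X → Prop} (hp : ∀ᵐ x ∂μ, p x) :
    ∀ᵐ x ∂μ, w x ≠ 0 → p (φ x) := by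
  have h1 : ∀ᵐ x ∂(wMeasure μ w), p (φ x) :=
    ae_of_ae_map hφ.aemeasurable (hac.ae_le hp)
  rw [wMeasure, ae_withDensity_iff (by fun_prop)] at h1
  filter_upwards [h1] with x hx hwx
  exact hx (by simpa using hwx)

variable (μ : Measure X) {φ : X → X} {w : X → ℂ}

/-- The domain `{f ∈ L²(μ) : w · (f ∘ φ) ∈ L²(μ)}` of the weighted composition operator. -/
def weightedCompDomain (hφ : Measurable φ) (hw : Measurable w)
    (hac : (wMeasure μ w).map φ ≪ μ) : Submodule ℂ (Lp ℂ 2 μ) where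
  carrier := {f | MemLp (fun x => w x * f (φ x)) 2 μ}
  zero_mem' := by
    refine (memLp_congr_ae ?_).1 (MemLp.zero' (p := 2) (μ := μ) (ε := ℂ))
    filter_upwards [ae_comp_of_ae hφ hw hac (Lp.coeFn_zero ℂ 2 μ)] with x hx
    by_cases h : w x = 0
    · simp [h]
    · rw [hx h]; simp
  add_mem' := by
    intro f g hf hg
    refine (memLp_congr_ae ?_).1 (MemLp.add hf hg)
    filter_upwards [ae_comp_of_ae hφ hw hac (Lp.coeFn_add f g)] with x hx
    by_cases h : w x = 0
    · simp [h]
    · rw [hx h]; simp [mul_add]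
  smul_mem' := by
    intro c f hf
    refine (memLp_congr_ae ?_).1 (MemLp.const_smul hf c)
    filter_upwards [ae_comp_of_ae hφ hw hac (Lp.coeFn_smul c f)] with x hx
    by_cases h : w x = 0
    · simp [h]
    · rw [hx h]; simp [mul_left_comm]

/-- The weighted composition operator `f ↦ w · (f ∘ φ)` in `L²(μ)`. -/
def weightedComp (hφ : Measurable φ) (hw : Measurable w)
    (hac : (wMeasure μ w).map φ ≪ μ) : Lp ℂ 2 μ →ₗ.[ℂ] Lp ℂ 2 μ where
  domain := weightedCompDomain μ hφ hw hac
  toFun :=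
    { toFun := fun f => MemLp.toLp (fun x => w x * (f : Lp ℂ 2 μ) (φ x)) f.2
      map_add' := by
        intro f g
        apply Lp.ext
        refine (MemLp.coeFn_toLp _).trans (.trans ?_ (Lp.coeFn_add _ _).symm)
        filter_upwards [ae_comp_of_ae hφ hw hac (Lp.coeFn_add (f : Lp ℂ 2 μ) g),
          MemLp.coeFn_toLp f.2, MemLp.coeFn_toLp g.2] with x hx hf hg
        rw [Pi.add_apply, hf, hg]
        by_cases h : w x = 0
        · simp [h]
        · rw [Submodule.coe_add, hx h]; simp [mul_add]
      map_smul' := by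
        intro c f
        apply Lp.ext
        refine (MemLp.coeFn_toLp _).trans (.trans ?_ (Lp.coeFn_smul _ _).symm)
        filter_upwards [ae_comp_of_ae hφ hw hac (Lp.coeFn_smul c (f : Lp ℂ 2 μ)),
          MemLp.coeFn_toLp f.2] with x hx hf
        rw [Pi.smul_apply, RingHom.id_apply, hf]
        by_cases h : w x = 0
        · simp [h]
        · rw [Submodule.coe_smul, hx h]; simp [mul_left_comm] }

variable {μ}

/-- The function `f_w`, equal to `f / w` on `{w ≠ 0}` and to `0` on `{w = 0}`. -/
def divWeight (w f : X → ℂ) : X → ℂ :=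
  {x | w x ≠ 0}.indicator fun x => f x / w x

theorem memLp_divWeight (hw : Measurable w) (f : Lp ℂ 2 μ) :
    MemLp (divWeight w f) 2 (wMeasure μ w) := by
  have hset : MeasurableSet {x | w x ≠ 0} := hw (measurableSet_singleton (0 : ℂ)).compl
  have hmeas : Measurable (divWeight w f) :=
    ((Lp.stronglyMeasurable f).measurable.div hw).indicator hset
  refine ⟨hmeas.aestronglyMeasurable, ?_⟩
  have hf := (Lp.memLp f).eLpNorm_lt_top
  rw [eLpNorm_lt_top_iff_lintegral_rpow_enorm_lt_top (by norm_num) (by norm_num)] at hf ⊢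
  refine lt_of_le_of_lt ?_ hf
  rw [wMeasure, lintegral_withDensity_eq_lintegral_mul _ (by fun_prop) (by fun_prop)]
  refine lintegral_mono fun x => ?_
  by_cases h : w x = 0
  · simp [h]
  · have h1 : ‖w x‖ₑ * ‖f x / w x‖ₑ = ‖f x‖ₑ := by
      rw [← enorm_mul, mul_div_cancel₀ _ h]
    simp only [Pi.mul_apply, divWeight, Set.indicator, Set.mem_ofPred_eq, ne_eq, h,
      not_false_eq_true, if_true, ENNReal.toReal_ofNat, ENNReal.rpow_ofNat]
    rw [← mul_pow, h1]

/-- The conditional expectation of `F ∈ L²(μ_w)` with respect to the σ-algebra `φ⁻¹(𝒜)` and the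
measure `μ_w`. -/
def wCondExp (hφ : Measurable φ) (F : Lp ℂ 2 (wMeasure μ w)) : X → ℂ :=
  ((condExpL2 ℂ ℂ hφ.comap_le F : Lp ℂ 2 (wMeasure μ w)) : X → ℂ)

variable (μ φ w) in
/-- `g` is a version of the formal expression `F ∘ φ⁻¹`: it is measurable, it vanishes a.e. `[μ]`
where the Radon-Nikodym derivative of `μ_w ∘ φ⁻¹` vanishes, and `F = g ∘ φ` a.e. `[μ_w]`. -/
structure IsCompInv (F g : X → ℂ) : Prop where
  measurable : Measurable g
  eq_zero : ∀ᵐ x ∂μ, radonNikodym μ φ w x = 0 → g x = 0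
  eq_comp : F =ᵐ[wMeasure μ w] g ∘ φ

theorem exists_isCompInv [SigmaFinite μ] (hφ : Measurable φ)
    (hac : (wMeasure μ w).map φ ≪ μ) (F : Lp ℂ 2 (wMeasure μ w)) :
    ∃ g, IsCompInv μ φ w (wCondExp hφ F) g := by
  have h1 : AEStronglyMeasurable[MeasurableSpace.comap φ inferInstance] (wCondExp hφ F)
      (wMeasure μ w) := aestronglyMeasurable_condExpL2 (𝕜 := ℂ) hφ.comap_le F
  obtain ⟨g, hg, hgφ⟩ := h1.stronglyMeasurable_mk.exists_eq_measurable_comp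
  have hh : MeasurableSet {x | radonNikodym μ φ w x ≠ 0} :=
    (Measure.measurable_rnDeriv _ _) (measurableSet_singleton 0).compl
  have : SFinite (wMeasure μ w) := by unfold wMeasure; infer_instance
  have h0 : ∀ᵐ x ∂(wMeasure μ w), 0 < radonNikodym μ φ w (φ x) :=
    ae_of_ae_map hφ.aemeasurable (Measure.rnDeriv_pos hac)
  refine ⟨{x | radonNikodym μ φ w x ≠ 0}.indicator g, hg.measurable.indicator hh, ?_, ?_⟩
  · exact .of_forall fun x hx => Set.indicator_of_notMem (by simpa using hx) _
  · filter_upwards [h1.ae_eq_mk, h0] with x hx hx0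
    rw [hx, hgφ, Function.comp_apply, Function.comp_apply,
      Set.indicator_of_mem (by simpa using hx0.ne')]

theorem IsCompInv.ae_eq [SigmaFinite μ] (hφ : Measurable φ)
    (hac : (wMeasure μ w).map φ ≪ μ) {F g g' : X → ℂ}
    (h : IsCompInv μ φ w F g) (h' : IsCompInv μ φ w F g') : g =ᵐ[μ] g' := by
  have : SFinite (wMeasure μ w) := by unfold wMeasure; infer_instance
  have h1 : ∀ᵐ x ∂(wMeasure μ w), g (φ x) = g' (φ x) := h.eq_comp.symm.trans h'.eq_comp
  have h2 : ∀ᵐ y ∂((wMeasure μ w).map φ), g y = g' y :=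
    (ae_map_iff hφ.aemeasurable (measurableSet_eq_fun h.measurable h'.measurable)).2 h1
  rw [← Measure.withDensity_rnDeriv_eq _ _ hac,
    ae_withDensity_iff (Measure.measurable_rnDeriv _ _)] at h2
  filter_upwards [h2, h.eq_zero, h'.eq_zero] with x hx h0 h0'
  by_cases hz : radonNikodym μ φ w x = 0
  · rw [h0 hz, h0' hz]
  · exact hx hz

/-- The function `E_{φ,w}(F) ∘ φ⁻¹` for `F ∈ L²(μ_w)`; it is unique up to sets of `μ`-measure
zero. -/
def condExpCompInv [SigmaFinite μ] (hφ : Measurable φ) (hac : (wMeasure μ w).map φ ≪ μ)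
    (F : Lp ℂ 2 (wMeasure μ w)) : X → ℂ :=
  (exists_isCompInv hφ hac F).choose

theorem isCompInv_condExpCompInv [SigmaFinite μ] (hφ : Measurable φ)
    (hac : (wMeasure μ w).map φ ≪ μ) (F : Lp ℂ 2 (wMeasure μ w)) :
    IsCompInv μ φ w (wCondExp hφ F) (condExpCompInv hφ hac F) :=
  (exists_isCompInv hφ hac F).choose_spec

end Operator

end WCO

end

noncomputable section

namespace WCO

/-! ### Consequences of the defining properties of a reciprocal -/

section Reciprocal

variable {H : Type*} [NormedAddCommGroup H] [InnerProductSpace ℂ H] [CompleteSpace H]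

/-! Write `T` for the weighted composition operator, `h` for the Radon–Nikodym derivative and `E`
for the conditional expectation. Division by `w` turns `T g` into `g ∘ φ` and preserves inner
products with vectors of `ran T`. As `g ∘ φ` is measurable for the pulled-back σ-algebra, pairing `T
g` with `r` only sees `E(r_w)`. Hence `(ran T)ᗮ` is `{r | E(r_w) = 0}`, and `f - T g ⊥ ran T`
exactly when `E(f_w) = g ∘ φ`.

The kernel consists of the functions vanishing on `{h ≠ 0}`, its complement of those vanishing on
`{h = 0}`. Cutting along these sets splits the domain of `T`, so a reciprocal `S` exists. Now `S f`
lies in `dom T ∩ (ker T)ᗮ` with `f - T (S f) ⊥ ran T`: it vanishes on `{h = 0}` and `S f ∘ φ =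
E(f_w)`, which characterizes `E(f_w) ∘ φ⁻¹`. Conversely, if that function `g` is in `L²(μ)`, then `g
∈ dom T`, and `f = T g + (f - T g)` lies in `ran T ⊕ (ran T)ᗮ`. -/

theorem isReciprocal_reciprocal {T : H →ₗ.[ℂ] H} (h : ∃ S, IsReciprocal T S) :
    IsReciprocal T (reciprocal T) := by
  rw [reciprocal, dif_pos h]
  exact h.choose_spec

theorem IsReciprocal.apply_mem_orthogonal_kernel {T S : H →ₗ.[ℂ] H} (h : IsReciprocal T S)
    (f : S.domain) : S f ∈ (kernel T)ᗮ := by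
  have hf : (f : H) ∈ range T ⊔ (range T)ᗮ := h.domain_eq.le f.2
  obtain ⟨_, ⟨g, rfl⟩, k, hk, hgk⟩ := Submodule.mem_sup.1 hf
  obtain ⟨h1, h2⟩ := h.symm_apply_apply g
  rw [← h.kernel_eq] at hk
  obtain ⟨k', hk', rfl⟩ := hk
  have hk0 : S k' = 0 := hk'
  have : f = ⟨T g, h1⟩ + k' := Subtype.ext (by simpa using hgk.symm)
  rw [this, S.map_add, h2, hk0, add_zero]
  exact Submodule.starProjection_apply_mem _ _

theorem IsReciprocal.sub_apply_apply_mem_orthogonal_range {T S : H →ₗ.[ℂ] H}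
    (h : IsReciprocal T S) (f : S.domain) (hf : S f ∈ T.domain) :
    (f : H) - T ⟨S f, hf⟩ ∈ (range T)ᗮ := by
  obtain ⟨h1, h2⟩ := h.apply_apply f
  rw [h2, ← Submodule.orthogonal_closure]
  exact Submodule.sub_starProjection_mem_orthogonal _

end Reciprocal

/-! ### Null sets and norms for `μ_w` and its image under `φ` -/

section Operator

variable {X : Type*} [MeasurableSpace X] {μ : Measure X} {φ : X → X} {w : X → ℂ}

theorem ae_wMeasure_iff (hw : Measurable w) {p : X → Prop} :
    (∀ᵐ x ∂(wMeasure μ w), p x) ↔ ∀ᵐ x ∂μ, w x ≠ 0 → p x := by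
  rw [wMeasure, ae_withDensity_iff (by fun_prop)]
  simp

/-- The image of `μ_w` under `φ` has density `radonNikodym μ φ w` with respect to `μ`, so its null
sets are those that are `μ`-null where the density is nonzero. -/
theorem ae_radonNikodym_ne_zero_iff [SigmaFinite μ] (hφ : Measurable φ)
    (hac : (wMeasure μ w).map φ ≪ μ) {p : X → Prop} (hp : MeasurableSet {x | p x}) :
    (∀ᵐ x ∂μ, radonNikodym μ φ w x ≠ 0 → p x) ↔ ∀ᵐ x ∂(wMeasure μ w), p (φ x) := by
  have : SFinite (wMeasure μ w) := by unfold wMeasure; infer_instance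
  rw [← ae_map_iff hφ.aemeasurable hp]
  conv_rhs => rw [← Measure.withDensity_rnDeriv_eq _ _ hac]
  rw [ae_withDensity_iff (Measure.measurable_rnDeriv _ _)]
  rfl

theorem eLpNorm_mul_weight (hw : Measurable w) {u : X → ℂ} (hu : Measurable u) :
    eLpNorm (fun x => w x * u x) 2 μ = eLpNorm u 2 (wMeasure μ w) := by
  rw [eLpNorm_eq_lintegral_rpow_enorm_toReal (by norm_num) (by norm_num),
    eLpNorm_eq_lintegral_rpow_enorm_toReal (by norm_num) (by norm_num), wMeasure,
    lintegral_withDensity_eq_lintegral_mul _ (by fun_prop) (by fun_prop)]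
  congr 1
  refine lintegral_congr fun x => ?_
  simp [enorm_mul, mul_pow]

theorem memLp_mul_weight_iff (hw : Measurable w) {u : X → ℂ} (hu : Measurable u) :
    MemLp (fun x => w x * u x) 2 μ ↔ MemLp u 2 (wMeasure μ w) := by
  have hm : AEStronglyMeasurable (fun x => w x * u x) μ := (hw.mul hu).aestronglyMeasurable
  simp only [MemLp, eLpNorm_mul_weight hw hu, hu.aestronglyMeasurable, hm, true_and]

/-! ### The passage from `f` to `f_w` -/

/-- The map `f ↦ f_w` from `L²(μ)` to `L²(μ_w)`. -/
def divWeightL2 (hw : Measurable w) (f : Lp ℂ 2 μ) : Lp ℂ 2 (wMeasure μ w) :=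
  (memLp_divWeight hw f).toLp

theorem ae_coeFn_divWeightL2 (hw : Measurable w) (f : Lp ℂ 2 μ) :
    ∀ᵐ x ∂μ, w x ≠ 0 → divWeightL2 hw f x = f x / w x := by
  rw [← ae_wMeasure_iff hw]
  have h0 : ∀ᵐ x ∂(wMeasure μ w), w x ≠ 0 := (ae_wMeasure_iff hw).2 (.of_forall fun _ h => h)
  filter_upwards [(memLp_divWeight hw f).coeFn_toLp, h0] with x hx hx0
  rw [divWeightL2, hx, divWeight, Set.indicator_of_mem (by exact hx0)]

theorem divWeightL2_sub (hw : Measurable w) (f g : Lp ℂ 2 μ) :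
    divWeightL2 hw (f - g) = divWeightL2 hw f - divWeightL2 hw g := by
  apply Lp.ext
  refine .trans ?_ (Lp.coeFn_sub _ _).symm
  refine (ae_wMeasure_iff hw).2 ?_
  filter_upwards [ae_coeFn_divWeightL2 hw f, ae_coeFn_divWeightL2 hw g,
    ae_coeFn_divWeightL2 hw (f - g), Lp.coeFn_sub f g] with x h1 h2 h3 h4 h
  rw [h3 h, h4, Pi.sub_apply, Pi.sub_apply, h1 h, h2 h, sub_div]

/-- The density `|w|²` cancels the two divisions by `w`. One factor vanishing on `{w = 0}` already
kills the integrand there, so `g` is arbitrary. -/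
theorem inner_divWeightL2 (hw : Measurable w) {f : Lp ℂ 2 μ} (hf : ∀ᵐ x ∂μ, w x = 0 → f x = 0)
    (g : Lp ℂ 2 μ) : inner ℂ (divWeightL2 hw f) (divWeightL2 hw g) = inner ℂ f g := by
  rw [L2.inner_def, L2.inner_def]
  refine (integral_withDensity_eq_integral_toReal_smul (by fun_prop)
    (.of_forall fun x => by finiteness) _).trans (integral_congr_ae ?_)
  filter_upwards [ae_coeFn_divWeightL2 hw f, ae_coeFn_divWeightL2 hw g, hf] with x h1 h2 h3
  by_cases h : w x = 0
  · simp [h, h3 h]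
  · rw [h1 h, h2 h]
    simp only [RCLike.inner_apply, map_div₀, ENNReal.toReal_pow, toReal_enorm, Complex.real_smul]
    have hc : (starRingEnd ℂ) (w x) ≠ 0 := by simpa using h
    push_cast
    rw [← Complex.mul_conj']
    field_simp

/-! ### Conditional expectation given `φ⁻¹(𝒜)` -/

theorem wCondExp_sub (hφ : Measurable φ) (F G : Lp ℂ 2 (wMeasure μ w)) :
    wCondExp hφ (F - G) =ᵐ[wMeasure μ w] wCondExp hφ F - wCondExp hφ G := by
  unfold wCondExp
  rw [map_sub, Submodule.coe_sub]
  exact Lp.coeFn_sub _ _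

theorem wCondExp_of_ae_eq_comp (hφ : Measurable φ) {F : Lp ℂ 2 (wMeasure μ w)} {g : X → ℂ}
    (hg : Measurable g) (hF : F =ᵐ[wMeasure μ w] g ∘ φ) :
    wCondExp hφ F =ᵐ[wMeasure μ w] g ∘ φ := by
  have hm : F ∈ lpMeas ℂ ℂ (MeasurableSpace.comap φ inferInstance) 2 (wMeasure μ w) :=
    mem_lpMeas_iff_aestronglyMeasurable.2
      ⟨g ∘ φ, (hg.comp (comap_measurable φ)).stronglyMeasurable, hF⟩
  have : (condExpL2 ℂ ℂ hφ.comap_le F : Lp ℂ 2 (wMeasure μ w)) = F :=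
    have : Fact (MeasurableSpace.comap φ inferInstance ≤ _) := ⟨hφ.comap_le⟩
    Submodule.starProjection_eq_self_iff.2 hm
  unfold wCondExp
  rwa [this]

/-! ### Range and kernel of the weighted composition operator -/

variable (hφ : Measurable φ) (hw : Measurable w) (hac : (wMeasure μ w).map φ ≪ μ)

theorem mem_weightedComp_domain_iff (f : Lp ℂ 2 μ) :
    f ∈ (weightedComp μ hφ hw hac).domain ↔ MemLp (f ∘ φ) 2 (wMeasure μ w) :=
  memLp_mul_weight_iff hw ((Lp.stronglyMeasurable f).measurable.comp hφ)

theorem coeFn_weightedComp (f : (weightedComp μ hφ hw hac).domain) :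
    weightedComp μ hφ hw hac f =ᵐ[μ] fun x => w x * (f : Lp ℂ 2 μ) (φ x) :=
  MemLp.coeFn_toLp f.2

theorem divWeightL2_weightedComp (f : (weightedComp μ hφ hw hac).domain) :
    divWeightL2 hw (weightedComp μ hφ hw hac f) =ᵐ[wMeasure μ w] (f : Lp ℂ 2 μ) ∘ φ := by
  refine (ae_wMeasure_iff hw).2 ?_
  filter_upwards [coeFn_weightedComp hφ hw hac f,
    ae_coeFn_divWeightL2 hw (weightedComp μ hφ hw hac f)] with x h1 h2 h
  rw [h2 h, h1, mul_div_cancel_left₀ _ h, Function.comp_apply]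

theorem inner_weightedComp (f : (weightedComp μ hφ hw hac).domain) (r : Lp ℂ 2 μ) :
    inner ℂ (weightedComp μ hφ hw hac f) r =
      ∫ x, inner ℂ ((f : Lp ℂ 2 μ) (φ x)) (wCondExp hφ (divWeightL2 hw r) x) ∂(wMeasure μ w) := by
  have h0 : ∀ᵐ x ∂μ, w x = 0 → weightedComp μ hφ hw hac f x = 0 := by
    filter_upwards [coeFn_weightedComp hφ hw hac f] with x hx h
    rw [hx, h, zero_mul]
  have hm : AEStronglyMeasurable[MeasurableSpace.comap φ inferInstance]
      (divWeightL2 hw (weightedComp μ hφ hw hac f)) (wMeasure μ w) :=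
    ⟨_, ((Lp.stronglyMeasurable (f : Lp ℂ 2 μ)).measurable.comp
      (comap_measurable φ)).stronglyMeasurable, divWeightL2_weightedComp hφ hw hac f⟩
  -- Self-adjointness of the conditional expectation is stated with the measurable vector on the
  -- right, hence the two conjugations.
  rw [← inner_divWeightL2 hw h0, ← inner_conj_symm,
    ← inner_condExpL2_eq_inner_fun hφ.comap_le _ _ hm, inner_conj_symm, L2.inner_def]
  refine integral_congr_ae ?_
  filter_upwards [divWeightL2_weightedComp hφ hw hac f] with x hx
  rw [hx]
  rfl

theorem mem_orthogonal_range_weightedComp_iff [SigmaFinite μ] (r : Lp ℂ 2 μ) :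
    r ∈ (range (weightedComp μ hφ hw hac))ᗮ ↔
      wCondExp hφ (divWeightL2 hw r) =ᵐ[wMeasure μ w] 0 := by
  constructor
  · intro hr
    obtain ⟨g, hg⟩ := exists_isCompInv hφ hac (divWeightL2 hw r)
    have hgL : MemLp (g ∘ φ) 2 (wMeasure μ w) := (memLp_congr_ae hg.eq_comp).1 (Lp.memLp _)
    -- On `A n` the measure is finite and `g` is bounded, so the truncation of `g` lies in `L²(μ)`
    -- and in the domain; testing `r` against its image gives the squared norm of the truncated `g ∘
    -- φ`.
    let A : ℕ → Set X := fun n => spanningSets μ n ∩ {x | ‖g x‖ ≤ n}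
    have hA : ∀ n, MeasurableSet (A n) := fun n =>
      (measurableSet_spanningSets μ n).inter (measurableSet_le hg.measurable.norm measurable_const)
    have hAt : ∀ n, μ (A n) < ∞ := fun n =>
      (measure_mono Set.inter_subset_left).trans_lt (measure_spanningSets_lt_top μ n)
    have key : ∀ n, ∀ᵐ x ∂(wMeasure μ w), φ x ∈ A n → g (φ x) = 0 := by
      intro n
      have hL : MemLp ((A n).indicator g) 2 μ := by
        rw [memLp_indicator_iff_restrict (hA n)]
        have : IsFiniteMeasure (μ.restrict (A n)) := ⟨by simpa using hAt n⟩
        refine MemLp.of_bound hg.measurable.aestronglyMeasurable n ?_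
        filter_upwards [ae_restrict_mem (hA n)] with x hx using hx.2
      have hcomp : hL.toLp ∘ φ =ᵐ[wMeasure μ w] (φ ⁻¹' A n).indicator (g ∘ φ) :=
        (ae_wMeasure_iff hw).2 (ae_comp_of_ae hφ hw hac hL.coeFn_toLp)
      have hd : hL.toLp ∈ (weightedComp μ hφ hw hac).domain := by
        rw [mem_weightedComp_domain_iff, memLp_congr_ae hcomp]
        exact hgL.indicator (hφ (hA n))
      have h0 := hr _ ⟨⟨hL.toLp, hd⟩, rfl⟩
      have h1 := inner_weightedComp hφ hw hac ⟨hL.toLp, hd⟩ r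
      have hI : MemLp ((φ ⁻¹' A n).indicator (g ∘ φ)) 2 (wMeasure μ w) :=
        hgL.indicator (hφ (hA n))
      have h2 : inner ℂ hI.toLp hI.toLp = (0 : ℂ) := by
        rw [← h0, LinearPMap.toFun_eq_coe, h1, L2.inner_def]
        refine integral_congr_ae ?_
        filter_upwards [hI.coeFn_toLp, hcomp, hg.eq_comp] with x h3 h4 h5
        rw [h3, h5, ← Function.comp_apply (f := hL.toLp), h4]
        by_cases hx : x ∈ φ ⁻¹' A n <;> simp [hx]
      have h3 := (Lp.eq_zero_iff_ae_eq_zero.1 (inner_self_eq_zero.1 h2))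
      filter_upwards [h3, hI.coeFn_toLp] with x h4 h5 hx
      rw [h4, Set.indicator_of_mem (by exact hx)] at h5
      exact h5.symm
    filter_upwards [hg.eq_comp, ae_all_iff.2 key] with x hx h
    rw [hx]
    obtain ⟨n, hn⟩ := exists_nat_ge ‖g (φ x)‖
    -- The sets `A n` exhaust `X`: this index satisfies both constraints.
    refine h (max n (spanningSetsIndex μ (φ x))) ⟨?_, ?_⟩
    · exact monotone_spanningSets μ (le_max_right _ _) (mem_spanningSetsIndex μ (φ x))
    · exact hn.trans (by exact_mod_cast le_max_left _ _)
  · rintro h _ ⟨f, rfl⟩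
    rw [LinearPMap.toFun_eq_coe, inner_weightedComp, ← integral_zero X ℂ (μ := wMeasure μ w)]
    refine integral_congr_ae ?_
    filter_upwards [h] with x hx
    simp [hx]

theorem sub_weightedComp_mem_orthogonal_range_iff [SigmaFinite μ] (f : Lp ℂ 2 μ)
    (g : (weightedComp μ hφ hw hac).domain) :
    f - weightedComp μ hφ hw hac g ∈ (range (weightedComp μ hφ hw hac))ᗮ ↔
      wCondExp hφ (divWeightL2 hw f) =ᵐ[wMeasure μ w] (g : Lp ℂ 2 μ) ∘ φ := by
  rw [mem_orthogonal_range_weightedComp_iff, divWeightL2_sub]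
  have h1 := wCondExp_sub hφ (divWeightL2 hw f) (divWeightL2 hw (weightedComp μ hφ hw hac g))
  have h2 := wCondExp_of_ae_eq_comp hφ (Lp.stronglyMeasurable (g : Lp ℂ 2 μ)).measurable
    (divWeightL2_weightedComp hφ hw hac g)
  constructor <;> intro h3 <;> filter_upwards [h1, h2, h3] with x h1 h2 h3
  · rw [h1, Pi.sub_apply, h2] at h3
    exact sub_eq_zero.1 h3
  · rw [h1, Pi.sub_apply, h2, h3, sub_self, Pi.zero_apply]

theorem mem_kernel_weightedComp_iff [SigmaFinite μ] (f : Lp ℂ 2 μ) :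
    f ∈ kernel (weightedComp μ hφ hw hac) ↔
      ∀ᵐ x ∂μ, radonNikodym μ φ w x ≠ 0 → f x = 0 := by
  rw [ae_radonNikodym_ne_zero_iff (p := fun x => f x = 0) hφ hac
    ((Lp.stronglyMeasurable f).measurable (measurableSet_singleton 0))]
  constructor
  · rintro ⟨g, hg, rfl⟩
    have hg0 : weightedComp μ hφ hw hac g = 0 := hg
    refine (ae_wMeasure_iff hw).2 ?_
    filter_upwards [coeFn_weightedComp hφ hw hac g, Lp.eq_zero_iff_ae_eq_zero.1 hg0]
      with x h1 h2 h
    rw [h2] at h1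
    exact (mul_eq_zero.1 h1.symm).resolve_left h
  · intro h
    have hd : f ∈ (weightedComp μ hφ hw hac).domain := by
      rw [mem_weightedComp_domain_iff]
      exact (memLp_congr_ae h).2 MemLp.zero'
    refine ⟨⟨f, hd⟩, ?_, rfl⟩
    change weightedComp μ hφ hw hac ⟨f, hd⟩ = 0
    rw [Lp.eq_zero_iff_ae_eq_zero]
    filter_upwards [coeFn_weightedComp hφ hw hac ⟨f, hd⟩, (ae_wMeasure_iff hw).1 h] with x h1 h2
    rw [h1]
    by_cases hx : w x = 0
    · simp [hx]
    · simp [h2 hx]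

theorem mem_orthogonal_kernel_weightedComp_iff [SigmaFinite μ] (f : Lp ℂ 2 μ) :
    f ∈ (kernel (weightedComp μ hφ hw hac))ᗮ ↔
      ∀ᵐ x ∂μ, radonNikodym μ φ w x = 0 → f x = 0 := by
  constructor
  · intro hf
    have hs : MeasurableSet {x | radonNikodym μ φ w x = 0} :=
      (Measure.measurable_rnDeriv _ _) (measurableSet_singleton 0)
    have hI : MemLp ({x | radonNikodym μ φ w x = 0}.indicator f) 2 μ := (Lp.memLp f).indicator hs
    have hk : hI.toLp ∈ kernel (weightedComp μ hφ hw hac) := by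
      rw [mem_kernel_weightedComp_iff]
      filter_upwards [hI.coeFn_toLp] with x hx h
      rw [hx, Set.indicator_of_notMem (by exact h)]
    have h0 : inner ℂ hI.toLp hI.toLp = (0 : ℂ) := by
      rw [← hf _ hk, L2.inner_def, L2.inner_def]
      refine integral_congr_ae ?_
      filter_upwards [hI.coeFn_toLp] with x hx
      rw [hx]
      by_cases h : radonNikodym μ φ w x = 0 <;> simp [h]
    filter_upwards [Lp.eq_zero_iff_ae_eq_zero.1 (inner_self_eq_zero.1 h0), hI.coeFn_toLp]
      with x h1 h2 h
    rw [h1, Set.indicator_of_mem (by exact h)] at h2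
    exact h2.symm
  · intro hf u hu
    rw [mem_kernel_weightedComp_iff] at hu
    rw [L2.inner_def, ← integral_zero X ℂ (μ := μ)]
    refine integral_congr_ae ?_
    filter_upwards [hf, hu] with x h1 h2
    by_cases h : radonNikodym μ φ w x = 0
    · simp [h1 h]
    · simp [h2 h]

/-- Cutting `f` off to `{h ≠ 0}` changes it only by a kernel element, and the kernel lies in the
domain, so the cut-off stays in the domain. -/
theorem weightedComp_domain_eq_sup [SigmaFinite μ] :
    (weightedComp μ hφ hw hac).domain = kernel (weightedComp μ hφ hw hac) ⊔
      ((weightedComp μ hφ hw hac).domain ⊓ (kernel (weightedComp μ hφ hw hac))ᗮ) := by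
  have hle : kernel (weightedComp μ hφ hw hac) ≤ (weightedComp μ hφ hw hac).domain := by
    rintro _ ⟨g, -, rfl⟩
    exact g.2
  refine le_antisymm (fun f hf => ?_) (sup_le hle inf_le_left)
  have hs : MeasurableSet {x | radonNikodym μ φ w x ≠ 0} :=
    (Measure.measurable_rnDeriv _ _) (measurableSet_singleton 0).compl
  have hI : MemLp ({x | radonNikodym μ φ w x ≠ 0}.indicator f) 2 μ := (Lp.memLp f).indicator hs
  have hk : f - hI.toLp ∈ kernel (weightedComp μ hφ hw hac) := by
    rw [mem_kernel_weightedComp_iff]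
    filter_upwards [hI.coeFn_toLp, Lp.coeFn_sub f hI.toLp] with x hx hx' h
    rw [hx', Pi.sub_apply, hx, Set.indicator_of_mem (by exact h), sub_self]
  refine Submodule.mem_sup.2 ⟨_, hk, hI.toLp, ⟨?_, ?_⟩, sub_add_cancel _ _⟩
  · simpa using Submodule.sub_mem _ hf (hle hk)
  · refine (mem_orthogonal_kernel_weightedComp_iff hφ hw hac _).2 ?_
    filter_upwards [hI.coeFn_toLp] with x hx h
    rw [hx, Set.indicator_of_notMem (by simpa using h)]

/-! ### Identification of the reciprocal -/

theorem IsReciprocal.coeFn_ae_eq_condExpCompInv [SigmaFinite μ] {S : Lp ℂ 2 μ →ₗ.[ℂ] Lp ℂ 2 μ}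
    (hS : IsReciprocal (weightedComp μ hφ hw hac) S) (f : S.domain) :
    S f =ᵐ[μ] condExpCompInv hφ hac (divWeightL2 hw (f : Lp ℂ 2 μ)) := by
  obtain ⟨hd, -⟩ := hS.apply_apply f
  refine IsCompInv.ae_eq hφ hac ⟨(Lp.stronglyMeasurable _).measurable, ?_, ?_⟩
    (isCompInv_condExpCompInv hφ hac _)
  · exact (mem_orthogonal_kernel_weightedComp_iff hφ hw hac _).1 (hS.apply_mem_orthogonal_kernel f)
  · exact (sub_weightedComp_mem_orthogonal_range_iff hφ hw hac _ ⟨_, hd⟩).1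
      (hS.sub_apply_apply_mem_orthogonal_range f hd)

theorem IsReciprocal.mem_domain_iff_memLp_condExpCompInv [SigmaFinite μ]
    {S : Lp ℂ 2 μ →ₗ.[ℂ] Lp ℂ 2 μ} (hS : IsReciprocal (weightedComp μ hφ hw hac) S)
    (f : Lp ℂ 2 μ) :
    f ∈ S.domain ↔ MemLp (condExpCompInv hφ hac (divWeightL2 hw f)) 2 μ := by
  constructor
  · intro hf
    exact (memLp_congr_ae (hS.coeFn_ae_eq_condExpCompInv hφ hw hac ⟨f, hf⟩)).1 (Lp.memLp _)
  · intro hg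
    have hcomp : wCondExp hφ (divWeightL2 hw f) =ᵐ[wMeasure μ w] hg.toLp ∘ φ := by
      refine (isCompInv_condExpCompInv hφ hac (divWeightL2 hw f)).eq_comp.trans ?_
      refine (ae_wMeasure_iff hw).2 ?_
      filter_upwards [ae_comp_of_ae hφ hw hac hg.coeFn_toLp] with x hx h using (hx h).symm
    -- Membership in the domain is automatic: the composition with `φ` is a conditional expectation,
    -- already in `L²(μ_w)`.
    have hd : hg.toLp ∈ (weightedComp μ hφ hw hac).domain := by
      rw [mem_weightedComp_domain_iff, ← memLp_congr_ae hcomp]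
      exact Lp.memLp _
    rw [hS.domain_eq]
    exact Submodule.mem_sup.2 ⟨_, ⟨⟨_, hd⟩, rfl⟩, _,
      (sub_weightedComp_mem_orthogonal_range_iff hφ hw hac f ⟨_, hd⟩).2 hcomp,
      add_sub_cancel _ _⟩

end Operator

end WCO

end

theorem theorem1 {X : Type*} [MeasurableSpace X] (μ : Measure X) [SigmaFinite μ]
    (φ : X → X) (hφ : Measurable φ) (w : X → ℂ) (hw : Measurable w)
    (hac : (WCO.wMeasure μ w).map φ ≪ μ)
    (hdense : Dense ((WCO.weightedComp μ hφ hw hac).domain : Set (Lp ℂ 2 μ))) :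
    WCO.IsReciprocal (WCO.weightedComp μ hφ hw hac)
        (WCO.reciprocal (WCO.weightedComp μ hφ hw hac)) ∧
      ((WCO.reciprocal (WCO.weightedComp μ hφ hw hac)).domain : Set (Lp ℂ 2 μ)) =
        {f : Lp ℂ 2 μ |
          MemLp (WCO.condExpCompInv hφ hac (WCO.memLp_divWeight hw f).toLp) 2 μ} ∧
      ∀ f : (WCO.reciprocal (WCO.weightedComp μ hφ hw hac)).domain,
        ((WCO.reciprocal (WCO.weightedComp μ hφ hw hac) f : Lp ℂ 2 μ) : X → ℂ) =ᵐ[μ]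
          WCO.condExpCompInv hφ hac (WCO.memLp_divWeight hw (f : Lp ℂ 2 μ)).toLp := by
  have hS := WCO.isReciprocal_reciprocal
    (WCO.exists_isReciprocal _ (WCO.weightedComp_domain_eq_sup hφ hw hac))
  exact ⟨hS, Set.ext fun f => hS.mem_domain_iff_memLp_condExpCompInv hφ hw hac f,
    fun f => hS.coeFn_ae_eq_condExpCompInv hφ hw hac f⟩
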